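/- Let $p$ be a prime, $e, m \ge 1$ integers, $q = p^e$, and let $\mathbb{F}_{q^m}$ be the finite field with $q^m$ elements. Let $f \in \mathbb{F}_{q^m}[x_1,\ldots,x_k]$ be a polynomial of (total) degree $d \ge 1$, and let $N(f = y^q - y)$ denote the number of solutions $(x_1,\ldots,x_k,y) \in \mathbb{F}_{q^m}^{k+1}$ of the Artin–Schreier type equation $f(x_1,\ldots,x_k) = y^q - y$. Then $$\nu_p\bigl(N(f = y^q - y)\bigr) \ \ge\ \left\lceil \frac{em(q-1)}{q^m-1} \left\lceil \frac{k(q^m-1)}{d(q-1)} \right\rceil \right\rceil,$$ where $\nu_p$ is the $p$-adic valuation, with $\nu_p(0) = \infty$. -/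

import Mathlib

/-- The number `N(f = y^q - y)` of solutions `(x_1, …, x_k, y) ∈ F^(k+1)` of the
Artin–Schreier type equation `f(x_1, …, x_k) = y^q - y`. -/
noncomputable def artinSchreierCount {F : Type*} [Field F] {k : ℕ}
    (f : MvPolynomial (Fin k) F) (q : ℕ) : ℕ :=
  Nat.card {z : (Fin k → F) × F // MvPolynomial.eval z.1 f = z.2 ^ q - z.2}

/-! Let h = em, n = p^h - 1, F the field with n + 1 elements, and `ψ` a nontrivial
Frobenius-invariant additive character. Orthogonality, with y summed out, gives N = Σ_{c^q = c} Σ_x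
ψ(c f(x)). Writing `ψ` as a polynomial of degree at most n in a Teichmüller character and
multiplying out over the monomials of f (`sum_addChar_eq_sum`) yields terms indexed by exponents r_i
≤ n. A nonzero term forces q - 1 ∣ Σ r_i (sum over c) and n ∣ Σ_i D_il r_i for every variable l (sum
over x_l).

Put ϖ = ‖ζ_p - 1‖, so ϖ^(p-1) = ‖p‖. Stickelberger's bound makes the r-th coefficient at most
ϖ^(digit sum of r), and each of the t variables with Σ_i D_il r_i = 0 contributes a factor p^h. The
digit sum is (p-1)/n times the sum of the h cyclic digit rotations of r. Rotation preserves the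
divisibilities, so for each rotation Σ r_i + tn is a multiple of q - 1 that is at least kn/d. Adding
over all rotations gives `mul_ceil_le_mul_sum_digitWeight`.

For Stickelberger, one Gauss sum is bounded below by a congruence. Integrality of Jacobi sums and
Frobenius invariance carry this to all powers, and ‖g(χ)‖‖g(χ⁻¹)‖ = ‖#F‖ turns lower bounds into
upper bounds. -/

section ResidueField

/-! ### Teichmüller characters from the residue field of the algebraic closure of ℚ_p. -/

open Polynomial

/-- A root in K of a monic lift is integral over O, hence lies in O, and can be reduced. -/
theorem ValuationSubring.isAlgClosed_residueField {K : Type*} [Field K] [IsAlgClosed K]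
    (O : ValuationSubring K) : IsAlgClosed (IsLocalRing.ResidueField O) := by
  refine IsAlgClosed.of_exists_root _ fun f hf hirr => ?_
  obtain ⟨g, hg, hdeg, hmonic⟩ := Polynomial.lifts_and_degree_eq_and_monic
    ((Polynomial.mem_lifts f).2 (Polynomial.map_surjective _ IsLocalRing.residue_surjective f)) hf
  have hdg : (g.map (algebraMap O K)).degree ≠ 0 := by
    rw [hmonic.degree_map, hdeg]
    exact fun h => hirr.not_isUnit (Polynomial.isUnit_iff_degree_eq_zero.2 h)
  obtain ⟨x, hx⟩ := IsAlgClosed.exists_root _ hdg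
  have hint : IsIntegral O x := ⟨g, hmonic, by rwa [IsRoot.def, eval_map] at hx⟩
  obtain ⟨y, rfl⟩ := IsIntegrallyClosed.isIntegral_iff.1 hint
  refine ⟨IsLocalRing.residue O y, ?_⟩
  rw [IsRoot.def, eval_map, eval₂_at_apply, map_eq_zero_iff _ (IsFractionRing.injective O K)] at hx
  rw [← hg, eval_map, eval₂_at_apply, hx, map_zero]

theorem PadicAlgCl.norm_natCast_prime (p : ℕ) [Fact p.Prime] :
    ‖(p : PadicAlgCl p)‖ = (p : ℝ)⁻¹ := by
  rw [← map_natCast (algebraMap ℚ_[p] (PadicAlgCl p)), PadicAlgCl.norm_extends, Padic.norm_p]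

theorem norm_eq_one_of_pow_eq_one {K : Type*} [NormedField K] {x : K} {n : ℕ} (h : x ^ n = 1)
    (hn : n ≠ 0) : ‖x‖ = 1 :=
  (pow_eq_one_iff_of_nonneg (norm_nonneg x) hn).1 (by rw [← norm_pow, h, norm_one])

/-- A Teichmüller character: a multiplicative character that is additive modulo the maximal
ideal. -/
theorem exists_teichmuller_mulChar (p : ℕ) [hp : Fact p.Prime] (F : Type*) [Field F] [Fintype F]
    [CharP F p] : ∃ χ : MulChar F (PadicAlgCl p), ∀ x y, ‖χ (x + y) - χ x - χ y‖ < 1 := by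
  classical
  let O := (Valued.v : Valuation (PadicAlgCl p) NNReal).valuationSubring
  have memO (x : PadicAlgCl p) : x ∈ O ↔ ‖x‖ ≤ 1 := Iff.rfl
  have lt_one (x : O) (hx : IsLocalRing.residue O x = 0) : ‖(x : PadicAlgCl p)‖ < 1 := by
    rw [IsLocalRing.residue_eq_zero_iff] at hx
    exact (Valuation.mem_maximalIdeal_iff _ _).1 hx
  have := ValuationSubring.isAlgClosed_residueField O
  have hpn : ‖((p : O) : PadicAlgCl p)‖ < 1 := by
    simpa [PadicAlgCl.norm_natCast_prime] using
      inv_lt_one_of_one_lt₀ (Nat.one_lt_cast.2 hp.out.one_lt)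
  have hchar : CharP (IsLocalRing.ResidueField O) p := by
    refine ringChar.of_eq (CharP.ringChar_of_prime_eq_zero hp.out ?_)
    rw [← map_natCast (IsLocalRing.residue O), IsLocalRing.residue_eq_zero_iff]
    exact (Valuation.mem_maximalIdeal_iff _ _).2 hpn
  let := ZMod.algebra F p
  let := ZMod.algebra (IsLocalRing.ResidueField O) p
  let φ : F →ₐ[ZMod p] IsLocalRing.ResidueField O := IsAlgClosed.lift
  obtain ⟨g, hg⟩ := IsCyclic.exists_generator (α := Fˣ)
  obtain ⟨ω, hω⟩ := HasEnoughRootsOfUnity.exists_primitiveRoot (PadicAlgCl p) (Fintype.card Fˣ)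
  have hcard : 0 < Fintype.card Fˣ := Fintype.card_pos
  have hωO : ω ∈ O := by
    rw [memO]
    exact (norm_eq_one_of_pow_eq_one hω.pow_eq_one hcard.ne').le
  have hω' : IsPrimitiveRoot (⟨ω, hωO⟩ : O) (Fintype.card Fˣ) :=
    IsPrimitiveRoot.of_map_of_injective (f := O.subtype) hω Subtype.val_injective
  -- X^N - 1 splits over O, so reducing it and evaluating at φ(g) shows that φ(g) is the residue of
  -- a root of unity μ; χ is then defined by g ↦ μ.
  have key := congrArg (fun P => eval₂ (IsLocalRing.residue O) (φ (g : F)) P)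
    (X_pow_sub_one_eq_prod hcard hω')
  simp only [eval₂_sub, eval₂_pow, eval₂_X, eval₂_one, eval₂_finsetProd, eval₂_C] at key
  rw [← map_pow, ← Units.val_pow_eq_pow_val, pow_card_eq_one, Units.val_one, map_one, sub_self,
    eq_comm, Finset.prod_eq_zero_iff] at key
  obtain ⟨μ, hμ, hμg⟩ := key
  rw [mem_nthRootsFinset hcard] at hμ
  have hu : IsUnit μ := IsUnit.of_pow_eq_one hμ hcard.ne'
  have hroot : hu.unit ∈ rootsOfUnity (Fintype.card Fˣ) O := by
    rw [mem_rootsOfUnity]; ext1; simpa using hμ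
  let χ := MulChar.ofRootOfUnity hroot hg
  have hχ (x : F) : IsLocalRing.residue O (χ x) = φ x := by
    rcases eq_or_ne x 0 with rfl | hx
    · rw [MulChar.map_zero, map_zero, map_zero]
    obtain ⟨x, rfl⟩ := hx.isUnit
    obtain ⟨i, rfl⟩ := (Submonoid.mem_powers_iff _ _).1 (mem_powers_iff_mem_zpowers.2 (hg x))
    have : χ g = μ := MulChar.ofRootOfUnity_spec hroot hg
    rw [Units.val_pow_eq_pow_val, map_pow, map_pow, map_pow, this, sub_eq_zero.1 hμg]
  refine ⟨χ.ringHomComp O.subtype, fun x y => ?_⟩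
  have := lt_one (χ (x + y) - χ x - χ y) (by simp [hχ])
  simpa using this

end ResidueField

/-! ### Absolute values of characters, Gauss sums and Jacobi sums. -/

section Ultrametric

variable {K : Type*} [NormedField K] {F : Type*} [Field F] [Fintype F]

theorem MulChar.norm_apply_eq_one (χ : MulChar F K) {x : F} (hx : x ≠ 0) : ‖χ x‖ = 1 := by
  have hc : Fintype.card F - 1 ≠ 0 := (Nat.sub_pos_of_lt Fintype.one_lt_card).ne'
  refine norm_eq_one_of_pow_eq_one (n := Fintype.card F - 1) ?_ hc
  rw [← map_pow, FiniteField.pow_card_sub_one_eq_one x hx, map_one]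

theorem MulChar.norm_apply_le_one (χ : MulChar F K) (x : F) : ‖χ x‖ ≤ 1 := by
  rcases eq_or_ne x 0 with rfl | hx
  · simp
  · exact (χ.norm_apply_eq_one hx).le

theorem AddChar.norm_apply_eq_one (ψ : AddChar F K) (x : F) : ‖ψ x‖ = 1 := by
  refine norm_eq_one_of_pow_eq_one (n := Fintype.card F) ?_ Fintype.card_ne_zero
  rw [← AddChar.map_nsmul_eq_pow, card_nsmul_eq_zero, AddChar.map_zero_eq_one]

theorem norm_gaussSum_one {ψ : AddChar F K} (hψ : ψ ≠ 1) :
    ‖gaussSum (1 : MulChar F K) ψ‖ = 1 := by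
  rw [gaussSum_one_left hψ, norm_neg, norm_one]

theorem gaussSum_pow_char_pow (p : ℕ) [hp : Fact p.Prime] [CharP F p] {ψ : AddChar F K}
    (hψ : ∀ x, ψ (x ^ p) = ψ x) (χ : MulChar F K) (j : ℕ) :
    gaussSum (χ ^ p ^ j) ψ = gaussSum χ ψ := by
  induction j with
  | zero => simp
  | succ j ih =>
    rw [← ih, pow_succ, pow_mul]
    refine Fintype.sum_bijective (frobenius F p) (bijective_frobenius F p) _ _ fun x => ?_
    rw [frobenius_def, hψ, MulChar.pow_apply' _ hp.out.ne_zero, map_pow]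

theorem norm_gaussSum_mul_norm_gaussSum_inv {ψ : AddChar F K} (hψ : ψ ≠ 1) {χ : MulChar F K}
    (hχ : χ ≠ 1) : ‖gaussSum χ ψ‖ * ‖gaussSum χ⁻¹ ψ‖ = ‖(Fintype.card F : K)‖ := by
  rw [← gaussSum_mul_gaussSum_eq_card hχ (AddChar.IsPrimitive.of_ne_one hψ), norm_mul,
    ← mul_gaussSum_inv_eq_gaussSum χ⁻¹ ψ, norm_mul, MulChar.norm_apply_eq_one _ (by simp), one_mul]

variable [IsUltrametricDist K]

theorem norm_finsetSum_lt_one {ι : Type*} {s : Finset ι} {f : ι → K} (h : ∀ i ∈ s, ‖f i‖ < 1) :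
    ‖∑ i ∈ s, f i‖ < 1 := by
  rcases s.eq_empty_or_nonempty with rfl | hs
  · simp
  · obtain ⟨i, hi, hle⟩ := IsUltrametricDist.exists_norm_finsetSum_le_of_nonempty hs f
    exact hle.trans_lt (h i hi)

theorem norm_sub_lt_one_trans {x y z : K} (hxy : ‖x - y‖ < 1) (hyz : ‖y - z‖ < 1) :
    ‖x - z‖ < 1 := by
  rw [← sub_add_sub_cancel x y z]
  exact (IsUltrametricDist.norm_add_le_max _ _).trans_lt (max_lt hxy hyz)

theorem norm_eq_one_of_norm_sub_lt_one {x y : K} (hxy : ‖x - y‖ < 1) (hy : ‖y‖ = 1) :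
    ‖x‖ = 1 := by
  have := IsUltrametricDist.norm_add_eq_max_of_norm_ne_norm (x := x - y) (y := y)
    (by rw [hy]; exact hxy.ne)
  rwa [sub_add_cancel, hy, max_eq_right hxy.le] at this

theorem norm_pow_sub_one_le {ζ : K} (hζ : ‖ζ‖ = 1) (i : ℕ) : ‖ζ ^ i - 1‖ ≤ ‖ζ - 1‖ := by
  rw [← mul_geom_sum, norm_mul]
  refine mul_le_of_le_one_right (norm_nonneg _) ?_
  exact IsUltrametricDist.norm_sum_le_of_forall_le_of_nonneg zero_le_one fun j _ => by
    rw [norm_pow, hζ, one_pow]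

/-- p = Φ_p(1) = ∏ (1 - μ), and all factors have the same norm because primitive roots are powers of
one another. -/
theorem IsPrimitiveRoot.norm_sub_one_pow {p : ℕ} [hp : Fact p.Prime] {ζ : K}
    (hζ : IsPrimitiveRoot ζ p) : ‖ζ - 1‖ ^ (p - 1) = ‖(p : K)‖ := by
  have h1 {μ : K} (hμ : IsPrimitiveRoot μ p) : ‖μ‖ = 1 :=
    norm_eq_one_of_pow_eq_one hμ.pow_eq_one hp.out.ne_zero
  have hle {μ ν : K} (hμ : IsPrimitiveRoot μ p) (hν : IsPrimitiveRoot ν p) :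
      ‖ν - 1‖ ≤ ‖μ - 1‖ := by
    obtain ⟨i, -, rfl⟩ := hμ.eq_pow_of_pow_eq_one hν.pow_eq_one
    exact norm_pow_sub_one_le (h1 hμ) i
  have key := Polynomial.eval_one_cyclotomic_prime (R := K) (p := p)
  rw [Polynomial.cyclotomic_eq_prod_X_sub_primitiveRoots hζ, Polynomial.eval_prod] at key
  rw [← key, norm_prod, Finset.prod_congr rfl (g := fun _ => ‖ζ - 1‖), Finset.prod_const,
    hζ.card_primitiveRoots, Nat.totient_prime hp.out]
  intro μ hμ
  have hμ := isPrimitiveRoot_of_mem_primitiveRoots hμ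
  rw [Polynomial.eval_sub, Polynomial.eval_X, Polynomial.eval_C, norm_sub_rev]
  exact le_antisymm (hle hζ hμ) (hle hμ hζ)

theorem norm_gaussSum_le_one (χ : MulChar F K) (ψ : AddChar F K) : ‖gaussSum χ ψ‖ ≤ 1 :=
  IsUltrametricDist.norm_sum_le_of_forall_le_of_nonneg zero_le_one fun x _ => by
    rw [norm_mul, ψ.norm_apply_eq_one, mul_one]
    exact χ.norm_apply_le_one x

theorem norm_jacobiSum_le_one (χ φ : MulChar F K) : ‖jacobiSum χ φ‖ ≤ 1 :=
  IsUltrametricDist.norm_sum_le_of_forall_le_of_nonneg zero_le_one fun x _ => by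
    rw [norm_mul]
    exact mul_le_one₀ (χ.norm_apply_le_one x) (norm_nonneg _) (φ.norm_apply_le_one _)

/-- g(χ)g(φ) = J(χ,φ)g(χφ) with J integral; when χφ = 1 the right side has norm 1. -/
theorem norm_gaussSum_mul_le {ψ : AddChar F K} (hψ : ψ ≠ 1) (χ φ : MulChar F K) :
    ‖gaussSum χ ψ‖ * ‖gaussSum φ ψ‖ ≤ ‖gaussSum (χ * φ) ψ‖ := by
  by_cases h : χ * φ = 1
  · rw [h, norm_gaussSum_one hψ]
    exact mul_le_one₀ (norm_gaussSum_le_one _ _) (norm_nonneg _) (norm_gaussSum_le_one _ _)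
  · rw [← norm_mul, ← jacobiSum_mul_nontrivial h, norm_mul]
    exact mul_le_of_le_one_right (norm_nonneg _) (norm_jacobiSum_le_one _ _)

theorem norm_gaussSum_pow_le {ψ : AddChar F K} (hψ : ψ ≠ 1) (χ : MulChar F K) (a : ℕ) :
    ‖gaussSum χ ψ‖ ^ a ≤ ‖gaussSum (χ ^ a) ψ‖ := by
  induction a with
  | zero => rw [pow_zero, pow_zero, norm_gaussSum_one hψ]
  | succ a ih =>
    rw [pow_succ, pow_succ]
    exact (mul_le_mul_of_nonneg_right ih (norm_nonneg _)).trans (norm_gaussSum_mul_le hψ _ _)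

theorem norm_gaussSum_prod_le {ψ : AddChar F K} (hψ : ψ ≠ 1) {ι : Type*} (s : Finset ι)
    (χ : ι → MulChar F K) : ∏ i ∈ s, ‖gaussSum (χ i) ψ‖ ≤ ‖gaussSum (∏ i ∈ s, χ i) ψ‖ := by
  classical
  induction s using Finset.induction_on with
  | empty => simp [norm_gaussSum_one hψ]
  | insert i s hi ih =>
    rw [Finset.prod_insert hi, Finset.prod_insert hi]
    exact (mul_le_mul_of_nonneg_left ih (norm_nonneg _)).trans (norm_gaussSum_mul_le hψ _ _)

end Ultrametric

/-! ### The first Gauss sum, by a congruence modulo the maximal ideal. -/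

theorem FiniteField.sum_inv_mul_trace (p : ℕ) [hp : Fact p.Prime] (F : Type*) [Field F] [Fintype F]
    [Algebra (ZMod p) F] :
    ∑ x : F, x⁻¹ * algebraMap (ZMod p) F (Algebra.trace (ZMod p) F x) = -1 := by
  classical
  have hcard : Fintype.card F = p ^ Module.finrank (ZMod p) F := by
    rw [Module.card_eq_pow_finrank (K := ZMod p), ZMod.card]
  obtain ⟨h, hh⟩ := Nat.exists_eq_succ_of_ne_zero
    (Module.finrank_pos (R := ZMod p) (M := F)).ne'
  simp_rw [FiniteField.algebraMap_trace_eq_sum_pow, Finset.mul_sum]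
  rw [Finset.sum_comm, hh, Finset.sum_range_succ', Finset.sum_eq_zero, zero_add]
  -- Since 0⁻¹ = 0, this term counts only nonzero x, giving #F - 1 = -1; the other power sums
  -- vanish.
  · have h1 (x : F) : x⁻¹ * x ^ Nat.card (ZMod p) ^ 0 = 1 - if x = 0 then 1 else 0 := by
      rw [pow_zero, pow_one]
      split_ifs with hx
      · simp [hx]
      · simp [hx]
    simp_rw [h1]
    simp
  · intro j hj
    have hpj : 1 < p ^ (j + 1) := Nat.one_lt_pow (Nat.succ_ne_zero j) hp.out.one_lt
    have hlt : p ^ (j + 1) < p ^ (h + 1) :=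
      Nat.pow_lt_pow_right hp.out.one_lt (by simpa using hj)
    rw [← FiniteField.sum_pow_lt_card_sub_one (K := F) (p ^ (j + 1) - 1)
      (by rw [hcard, hh, Nat.succ_eq_add_one]; omega)]
    refine Finset.sum_congr rfl fun x _ => ?_
    rw [Nat.card_zmod]
    rcases eq_or_ne x 0 with rfl | hx
    · rw [inv_zero, zero_mul, zero_pow (by omega)]
    · rw [pow_sub₀ _ hx hpj.le, pow_one, mul_comm]

theorem norm_map_finsetSum_sub_lt_one {K : Type*} [NormedField K] [IsUltrametricDist K]
    {F : Type*} [Field F] {χ : MulChar F K} (hχ : ∀ x y, ‖χ (x + y) - χ x - χ y‖ < 1)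
    {ι : Type*} (s : Finset ι) (f : ι → F) : ‖χ (∑ i ∈ s, f i) - ∑ i ∈ s, χ (f i)‖ < 1 := by
  classical
  induction s using Finset.induction_on with
  | empty => simp [MulChar.map_zero]
  | insert i s hi ih =>
    rw [Finset.sum_insert hi, Finset.sum_insert hi]
    refine norm_sub_lt_one_trans (y := χ (f i) + χ (∑ i ∈ s, f i)) ?_ ?_
    · rw [← sub_sub]
      exact hχ _ _
    · rwa [add_sub_add_left_eq_sub]

theorem norm_map_natCast_sub_lt_one {K : Type*} [NormedField K] [IsUltrametricDist K]
    {F : Type*} [Field F] {χ : MulChar F K} (hχ : ∀ x y, ‖χ (x + y) - χ x - χ y‖ < 1) (t : ℕ) :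
    ‖χ (t : F) - t‖ < 1 := by
  simpa using norm_map_finsetSum_sub_lt_one hχ (Finset.range t) fun _ => (1 : F)

section Teichmuller

variable {K : Type*} [NormedField K] {F : Type*} [Field F] [Fintype F] {χ : MulChar F K}

/-- Otherwise the additivity defect at (x - 1, 1) is -χ(x - 1), of norm 1. -/
theorem eq_one_of_map_eq_one (hχ : ∀ x y, ‖χ (x + y) - χ x - χ y‖ < 1) {x : F} (hx : χ x = 1) :
    x = 1 := by
  by_contra hne
  have := hχ (x - 1) 1
  rw [sub_add_cancel, hx, map_one, sub_sub_cancel_left, norm_neg,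
    χ.norm_apply_eq_one (sub_ne_zero.2 hne)] at this
  exact lt_irrefl _ this

theorem orderOf_eq_card_sub_one (hχ : ∀ x y, ‖χ (x + y) - χ x - χ y‖ < 1) :
    orderOf χ = Fintype.card F - 1 := by
  classical
  refine Nat.dvd_antisymm χ.orderOf_dvd_card_sub_one ?_
  obtain ⟨g, hg⟩ := IsCyclic.exists_generator (α := Fˣ)
  rw [← Fintype.card_units, ← Nat.card_eq_fintype_card, ← orderOf_eq_card_of_forall_mem_zpowers hg]
  refine orderOf_dvd_of_pow_eq_one ?_
  ext1
  refine eq_one_of_map_eq_one hχ ?_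
  rw [Units.val_pow_eq_pow_val, map_pow, ← MulChar.pow_apply_coe, pow_orderOf_eq_one,
    MulChar.one_apply_coe]

variable [IsUltrametricDist K]

theorem norm_sub_one_le_norm_gaussSum_inv {p : ℕ} [hp : Fact p.Prime] [Algebra (ZMod p) F]
    (hχ : ∀ x y, ‖χ (x + y) - χ x - χ y‖ < 1) (hχ1 : χ ≠ 1) {ζ : K} (hζ1 : ‖ζ‖ = 1)
    (hζ : ‖ζ - 1‖ < 1) {ψ : AddChar F K}
    (hψ : ∀ x, ψ x = ζ ^ (Algebra.trace (ZMod p) F x).val) :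
    ‖ζ - 1‖ ≤ ‖gaussSum χ⁻¹ ψ‖ := by
  let t (x : F) : ℕ := (Algebra.trace (ZMod p) F x).val
  -- Subtracting Σ χ⁻¹(x) = 0 replaces ψ(x) by ζ^t - 1, which is divisible by ζ - 1.
  have hg : gaussSum χ⁻¹ ψ = (ζ - 1) * ∑ x, χ⁻¹ x * ∑ i ∈ Finset.range (t x), ζ ^ i := by
    rw [← sub_zero (gaussSum χ⁻¹ ψ), ← MulChar.sum_eq_zero_of_ne_one (inv_ne_one.2 hχ1), gaussSum,
      ← Finset.sum_sub_distrib, Finset.mul_sum]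
    refine Finset.sum_congr rfl fun x _ => ?_
    rw [mul_left_comm, mul_geom_sum, hψ, mul_sub_one]
  -- As ζ ≡ 1, the cofactor is congruent to χ(Σ x⁻¹ Tr x) = χ(-1).
  have hA : ‖∑ x, χ⁻¹ x * ∑ i ∈ Finset.range (t x), ζ ^ i‖ = 1 := by
    refine norm_eq_one_of_norm_sub_lt_one (y := χ (-1)) ?_ (χ.norm_apply_eq_one (by simp))
    rw [← FiniteField.sum_inv_mul_trace p F]
    refine norm_sub_lt_one_trans ?_
      ((norm_sub_rev _ _).trans_lt (norm_map_finsetSum_sub_lt_one hχ _ _))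
    rw [← Finset.sum_sub_distrib]
    refine norm_finsetSum_lt_one fun x _ => ?_
    have hx : algebraMap (ZMod p) F (Algebra.trace (ZMod p) F x) = (t x : F) := by
      rw [← map_natCast (algebraMap (ZMod p) F), ZMod.natCast_rightInverse]
    rw [map_mul, MulChar.inv_apply', ← mul_sub, norm_mul, hx]
    refine (mul_le_of_le_one_left (norm_nonneg _) (χ.norm_apply_le_one _)).trans_lt ?_
    refine norm_sub_lt_one_trans (y := (t x : K)) ?_
      ((norm_sub_rev _ _).trans_lt (norm_map_natCast_sub_lt_one hχ _))
    have : (t x : K) = ∑ i ∈ Finset.range (t x), 1 := by simp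
    rw [this, ← Finset.sum_sub_distrib]
    exact norm_finsetSum_lt_one fun i _ => (norm_pow_sub_one_le hζ1 i).trans_lt hζ
  rw [hg, norm_mul, hA, mul_one]

end Teichmuller

/-! ### Base-p digit sums through cyclic rotations. -/

/-- The representative of `p ^ j * r` modulo `n` in `{0, …, n}` that is `n` for `r = n` and lies in
`{0, …, n - 1}` for `r < n`. If `n + 1 = p ^ h`, it rotates the `h` base-`p` digits of `r`. -/
def digitRotate (p n j r : ℕ) : ℕ := if r = n then n else p ^ j * r % n

/-- For `n + 1 = p ^ h` and `r ≤ n` this is the sum of the base-`p` digits of `r`. -/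
def digitWeight (p n h r : ℕ) : ℕ := (p - 1) * (∑ j ∈ Finset.range h, digitRotate p n j r) / n

section Digits

variable {p n h r : ℕ}

theorem digitRotate_self (p n j : ℕ) : digitRotate p n j n = n := if_pos rfl

theorem digitRotate_of_lt (j : ℕ) (hr : r < n) : digitRotate p n j r = p ^ j * r % n :=
  if_neg hr.ne

theorem digitRotate_modEq (p n j r : ℕ) : digitRotate p n j r ≡ p ^ j * r [MOD n] := by
  unfold digitRotate
  split_ifs with h
  · subst h
    exact (Nat.modEq_zero_iff_dvd.2 dvd_rfl).trans (Nat.modEq_zero_iff_dvd.2 (dvd_mul_left _ _)).symm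
  · exact Nat.mod_modEq _ _

theorem coprime_of_add_one_eq_pow (hn : n + 1 = p ^ h) (hn0 : 0 < n) : n.Coprime p := by
  have h0 : h ≠ 0 := by
    rintro rfl
    simp at hn
    omega
  have : n.Coprime (p ^ h) := by
    rw [← hn]
    simp
  exact this.coprime_dvd_right (dvd_pow_self p h0)

theorem digitRotate_pos (hn : n + 1 = p ^ h) (hr0 : 0 < r) (hr : r ≤ n) (j : ℕ) :
    0 < digitRotate p n j r := by
  rcases hr.eq_or_lt with rfl | hr
  · rwa [digitRotate_self]
  · rw [digitRotate_of_lt j hr, Nat.pos_iff_ne_zero, ne_eq, ← Nat.dvd_iff_mod_eq_zero]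
    intro hdvd
    have := ((coprime_of_add_one_eq_pow hn (by omega)).pow_right j).dvd_of_dvd_mul_left hdvd
    exact absurd (Nat.le_of_dvd hr0 this) (by omega)

theorem digitRotate_sub_add (hn : n + 1 = p ^ h) (hr0 : 0 < r) (hr : r < n) (j : ℕ) :
    digitRotate p n j (n - r) + digitRotate p n j r = n := by
  have h1 := digitRotate_pos hn hr0 hr.le j
  have h2 := digitRotate_pos (r := n - r) hn (by omega) (by omega) j
  have h3 : digitRotate p n j (n - r) + digitRotate p n j r ≡ 0 [MOD n] := by
    refine ((digitRotate_modEq p n j (n - r)).add (digitRotate_modEq p n j r)).trans ?_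
    rw [← mul_add, Nat.sub_add_cancel hr.le]
    exact Nat.modEq_zero_iff_dvd.2 (dvd_mul_left _ _)
  have h4 : digitRotate p n j r < n := by
    rw [digitRotate_of_lt j hr]; exact Nat.mod_lt _ (by omega)
  have h5 : digitRotate p n j (n - r) < n := by
    rw [digitRotate_of_lt j (by omega)]; exact Nat.mod_lt _ (by omega)
  obtain ⟨c, hc⟩ := Nat.modEq_zero_iff_dvd.1 h3
  have hc2 : c < 2 := by
    by_contra! hc2
    have := Nat.mul_le_mul_left n hc2
    omega
  interval_cases c <;> omega

theorem exists_digits (hn : n + 1 = p ^ h) (hr : r < n) :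
    ∃ a : ℕ → ℕ, r = ∑ j ∈ Finset.range h, a j * p ^ (h - 1 - j) ∧
      (p - 1) * ∑ j ∈ Finset.range h, digitRotate p n j r = n * ∑ j ∈ Finset.range h, a j := by
  have hn0 : 0 < n := by omega
  -- The quotient when the j-th rotation is multiplied by p modulo n is its leading digit; as p^h ≡
  -- 1, the h steps close up into a cycle.
  refine ⟨fun j => p * digitRotate p n j r / n, ?_, ?_⟩
  all_goals
    have hstep (j : ℕ) : p * digitRotate p n j r =
        digitRotate p n (j + 1) r + n * (p * digitRotate p n j r / n) := by
      rw [digitRotate_of_lt (j + 1) hr]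
      nth_rw 1 [← Nat.mod_add_div (p * digitRotate p n j r) n]
      rw [digitRotate_of_lt j hr, Nat.mul_mod_mod, ← mul_assoc, ← pow_succ']
    have h0 : digitRotate p n 0 r = r := by
      rw [digitRotate_of_lt 0 hr, pow_zero, one_mul, Nat.mod_eq_of_lt hr]
    have hh : digitRotate p n h r = r := by
      rw [digitRotate_of_lt h hr, ← hn, add_mul, one_mul, Nat.mul_add_mod, Nat.mod_eq_of_lt hr]
    set a : ℕ → ℕ := fun j => p * digitRotate p n j r / n
  · have key (i : ℕ) : p ^ i * r = digitRotate p n i r +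
        n * ∑ j ∈ Finset.range i, a j * p ^ (i - 1 - j) := by
      induction i with
      | zero => simp [h0]
      | succ i ih =>
        rw [pow_succ', mul_assoc, ih, mul_add, hstep i, Finset.sum_range_succ]
        have : ∑ j ∈ Finset.range i, a j * p ^ (i + 1 - 1 - j) =
            p * ∑ j ∈ Finset.range i, a j * p ^ (i - 1 - j) := by
          rw [Finset.mul_sum]
          refine Finset.sum_congr rfl fun j hj => ?_
          have : i + 1 - 1 - j = (i - 1 - j) + 1 := by
            have := Finset.mem_range.1 hj
            omega
          rw [this, pow_succ]
          ring
        rw [this, Nat.add_sub_cancel, Nat.sub_self, pow_zero]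
        simp only [a]
        ring
    have := key h
    rw [hh, ← hn, add_mul, one_mul, add_comm] at this
    exact Nat.eq_of_mul_eq_mul_left hn0 (Nat.add_left_cancel this)
  · have h1 : p * ∑ j ∈ Finset.range h, digitRotate p n j r =
        ∑ j ∈ Finset.range h, digitRotate p n (j + 1) r + n * ∑ j ∈ Finset.range h, a j := by
      rw [Finset.mul_sum, Finset.mul_sum, ← Finset.sum_add_distrib]
      exact Finset.sum_congr rfl fun j _ => hstep j
    have h2 : ∑ j ∈ Finset.range h, digitRotate p n (j + 1) r =
        ∑ j ∈ Finset.range h, digitRotate p n j r := by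
      have := (Finset.sum_range_succ' (digitRotate p n · r) h).symm.trans
        (Finset.sum_range_succ (digitRotate p n · r) h)
      rw [h0, hh] at this
      exact Nat.add_right_cancel this
    rw [Nat.sub_mul, one_mul, h1, h2, Nat.add_sub_cancel_left]

theorem digitWeight_self (hn0 : 0 < n) : digitWeight p n h n = (p - 1) * h := by
  simp only [digitWeight, digitRotate_self, Finset.sum_const, Finset.card_range, smul_eq_mul]
  rw [← mul_assoc, Nat.mul_div_cancel _ hn0]

theorem mul_digitWeight (hn : n + 1 = p ^ h) (hn0 : 0 < n) (hr : r ≤ n) :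
    n * digitWeight p n h r = (p - 1) * ∑ j ∈ Finset.range h, digitRotate p n j r := by
  refine Nat.mul_div_cancel' ?_
  rcases hr.eq_or_lt with rfl | hr
  · simp only [digitRotate_self, Finset.sum_const, Finset.card_range, smul_eq_mul]
    exact ⟨(p - 1) * h, by ring⟩
  · obtain ⟨a, -, ha⟩ := exists_digits hn hr
    exact ⟨_, ha⟩

theorem digitWeight_zero (hn0 : 0 < n) : digitWeight p n h 0 = 0 := by
  simp [digitWeight, digitRotate, hn0.ne]

theorem digitWeight_sub_add (hn : n + 1 = p ^ h) (hr0 : 0 < r) (hr : r < n) :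
    digitWeight p n h (n - r) + digitWeight p n h r = (p - 1) * h := by
  have hn0 : 0 < n := by omega
  refine Nat.eq_of_mul_eq_mul_left hn0 ?_
  rw [mul_add, mul_digitWeight hn hn0 (Nat.sub_le n r), mul_digitWeight hn hn0 hr.le,
    ← mul_add, ← Finset.sum_add_distrib,
    Finset.sum_congr rfl fun j _ => digitRotate_sub_add hn hr0 hr j, Finset.sum_const,
    Finset.card_range, smul_eq_mul]
  ring

theorem exists_digits_sum_eq_digitWeight (hn : n + 1 = p ^ h) (hr : r < n) :
    ∃ a : ℕ → ℕ, r = ∑ j ∈ Finset.range h, a j * p ^ (h - 1 - j) ∧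
      ∑ j ∈ Finset.range h, a j = digitWeight p n h r := by
  obtain ⟨a, h1, h2⟩ := exists_digits hn hr
  have hn0 : 0 < n := by omega
  exact ⟨a, h1, Nat.eq_of_mul_eq_mul_left hn0 (by rw [mul_digitWeight hn hn0 hr.le, h2])⟩

end Digits

/-! ### Stickelberger's bound. -/

section Stickelberger

variable {K : Type*} [NormedField K] [IsUltrametricDist K] {F : Type*} [Field F] [Fintype F]
  {χ : MulChar F K} {ψ : AddChar F K} {p n h : ℕ} {ϖ : ℝ}

/-- χ^r is a product of Frobenius twists χ^(p^i), as many as the digit sum of r, each with the same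
Gauss sum as χ. -/
theorem pow_digitWeight_le_norm_gaussSum (hp : p.Prime) [CharP F p] (hn : n + 1 = p ^ h)
    (hψ1 : ψ ≠ 1) (hψ : ∀ x, ψ (x ^ p) = ψ x) (hϖ : 0 ≤ ϖ) (hχ : ϖ ≤ ‖gaussSum χ ψ‖) {r : ℕ}
    (hr : r < n) : ϖ ^ digitWeight p n h r ≤ ‖gaussSum (χ ^ r) ψ‖ := by
  have : Fact p.Prime := ⟨hp⟩
  obtain ⟨a, h1, h2⟩ := exists_digits_sum_eq_digitWeight hn hr
  have hprod : χ ^ r = ∏ j ∈ Finset.range h, (χ ^ p ^ (h - 1 - j)) ^ a j := by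
    conv_lhs => rw [h1]
    rw [← Finset.prod_pow_eq_pow_sum]
    exact Finset.prod_congr rfl fun j _ => by rw [← pow_mul, mul_comm]
  rw [hprod, ← h2, ← Finset.prod_pow_eq_pow_sum]
  refine (Finset.prod_le_prod (fun j _ => pow_nonneg hϖ _) fun j _ => ?_).trans
    (norm_gaussSum_prod_le hψ1 _ _)
  refine le_trans ?_ (norm_gaussSum_pow_le hψ1 _ _)
  rw [gaussSum_pow_char_pow p hψ]
  exact pow_le_pow_left₀ hϖ hχ _

/-- The lower bound of Stickelberger's theorem for the valuation of a Gauss sum. -/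
theorem norm_gaussSum_le_pow_digitWeight (hp : p.Prime) [CharP F p] (hn : n + 1 = p ^ h)
    (hcard : Fintype.card F = p ^ h) (hord : orderOf χ = n)
    (hψ1 : ψ ≠ 1) (hψ : ∀ x, ψ (x ^ p) = ψ x) (hϖ : 0 < ϖ) (hϖp : ϖ ^ (p - 1) = ‖(p : K)‖)
    (hχ : ϖ ≤ ‖gaussSum χ ψ‖) {r : ℕ} (hr0 : 0 < r) (hr : r < n) :
    ‖gaussSum (χ ^ r) ψ‖ ≤ ϖ ^ digitWeight p n h r := by
  have hne : χ ^ r ≠ 1 := pow_ne_one_of_lt_orderOf hr0.ne' (hord ▸ hr)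
  have hinv : (χ ^ r)⁻¹ = χ ^ (n - r) := by
    rw [inv_eq_iff_mul_eq_one, ← pow_add, Nat.add_sub_cancel' hr.le, ← hord, pow_orderOf_eq_one]
  have h1 := norm_gaussSum_mul_norm_gaussSum_inv hψ1 hne
  have h2 := pow_digitWeight_le_norm_gaussSum hp hn hψ1 hψ hϖ.le hχ (r := n - r) (by omega)
  rw [hinv, hcard, Nat.cast_pow, norm_pow, ← hϖp, ← pow_mul, ← digitWeight_sub_add hn hr0 hr,
    pow_add, mul_comm] at h1
  refine le_of_mul_le_mul_left ?_ (pow_pos hϖ (digitWeight p n h (n - r)))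
  rw [← h1]
  exact mul_le_mul_of_nonneg_right h2 (norm_nonneg _)

/-- The coefficient of `χ⁻¹(x) ^ r` in the expansion of `ψ` as a polynomial in `χ⁻¹`. -/
noncomputable def addCharCoeff (χ : MulChar F K) (ψ : AddChar F K) (n r : ℕ) : K :=
  if r = 0 then 1 else if r = n then -((n + 1 : ℕ) / n : K) else gaussSum (χ ^ r) ψ / n

theorem norm_addCharCoeff_le (hp : p.Prime) [CharP F p] (hn : n + 1 = p ^ h) (hn0 : 0 < n)
    (hcard : Fintype.card F = p ^ h) (hord : orderOf χ = n) (hnK : ‖(n : K)‖ = 1)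
    (hψ1 : ψ ≠ 1) (hψ : ∀ x, ψ (x ^ p) = ψ x) (hϖ : 0 < ϖ) (hϖp : ϖ ^ (p - 1) = ‖(p : K)‖)
    -- For n = 1 the character is trivial, but then r is 0 or n and no Gauss sum occurs.
    (hχ : 1 < n → ϖ ≤ ‖gaussSum χ ψ‖) {r : ℕ} (hr : r ≤ n) :
    ‖addCharCoeff χ ψ n r‖ ≤ ϖ ^ digitWeight p n h r := by
  unfold addCharCoeff
  split_ifs with h0 hrn
  · rw [h0, digitWeight_zero hn0, pow_zero, norm_one]
  · rw [hrn, digitWeight_self hn0, norm_neg, norm_div, hnK, div_one, hn, Nat.cast_pow, norm_pow,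
      ← hϖp, pow_mul]
  · rw [norm_div, hnK, div_one]
    exact norm_gaussSum_le_pow_digitWeight hp hn hcard hord hψ1 hψ hϖ hϖp (hχ (by omega))
      (by omega) (by omega)

end Stickelberger

/-! ### Fourier expansion of the additive character. -/

section Expansion

variable {K : Type*} [NormedField K] {F : Type*} [Field F] [Fintype F] {χ : MulChar F K}
  {ψ : AddChar F K} {n : ℕ}

theorem sum_pow_mul_inv_pow [DecidableEq F] (hn : n + 1 = Fintype.card F)
    (hχ : ∀ x, χ x = 1 → x = 1) {a : F} (ha : a ≠ 0) (x : F) :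
    ∑ r ∈ Finset.range n, (χ⁻¹ ^ r) x * χ a ^ r = if x = a then (n : K) else 0 := by
  rcases eq_or_ne x 0 with rfl | hx
  · simp [ha.symm, MulChar.map_zero]
  have hterm (r : ℕ) : (χ⁻¹ ^ r) x * χ a ^ r = χ (x⁻¹ * a) ^ r := by
    obtain ⟨u, rfl⟩ := hx.isUnit
    rw [MulChar.pow_apply_coe, MulChar.inv_apply', ← mul_pow, ← map_mul]
  simp_rw [hterm]
  split_ifs with hxa
  · subst hxa
    simp [hx]
  · have h1 : χ (x⁻¹ * a) ≠ 1 := fun h => hxa (by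
      have := hχ _ h
      rwa [inv_mul_eq_one₀ hx] at this)
    have h2 : χ (x⁻¹ * a) ^ n = 1 := by
      have : n = Fintype.card F - 1 := by omega
      rw [← map_pow, this, FiniteField.pow_card_sub_one_eq_one _ (by simp [hx, ha]), map_one]
    have h3 := mul_geom_sum (χ (x⁻¹ * a)) n
    rw [h2, sub_self] at h3
    exact (mul_eq_zero.1 h3).resolve_left (sub_ne_zero.2 h1)

/-- Exponents 0 and n agree on nonzero a, where Fourier inversion requires total coefficient -1/n.
The value ψ(0) = 1 forces 1 at exponent 0, leaving -(n+1)/n at exponent n. -/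
theorem addChar_eq_sum (hn : n + 1 = Fintype.card F) (hn0 : 0 < n) (hnK : (n : K) ≠ 0)
    (hχ : ∀ x, χ x = 1 → x = 1) (hψ : ψ ≠ 1) (a : F) :
    ψ a = ∑ r ∈ Finset.range (n + 1), addCharCoeff χ⁻¹ ψ n r * χ a ^ r := by
  classical
  rcases eq_or_ne a 0 with rfl | ha
  · rw [Finset.sum_range_succ', Finset.sum_eq_zero fun r _ => by
      rw [MulChar.map_zero, zero_pow (Nat.succ_ne_zero r), mul_zero]]
    simp [addCharCoeff]
  obtain ⟨l, rfl⟩ := Nat.exists_eq_succ_of_ne_zero hn0.ne'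
  have hpow : χ a ^ (l + 1) = 1 := by
    have : l + 1 = Fintype.card F - 1 := by omega
    rw [← map_pow, this, FiniteField.pow_card_sub_one_eq_one _ ha, map_one]
  have key : (l.succ : K) * ψ a =
      ∑ r ∈ Finset.range l.succ, gaussSum (χ⁻¹ ^ r) ψ * χ a ^ r := by
    simp_rw [gaussSum, Finset.sum_mul]
    rw [Finset.sum_comm]
    simp_rw [mul_right_comm _ (ψ _), ← Finset.sum_mul, sum_pow_mul_inv_pow hn hχ ha]
    simp
  rw [eq_comm, ← mul_right_inj' hnK, key, Finset.sum_range_succ, Finset.sum_range_succ',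
    Finset.sum_range_succ' _ l, pow_zero, pow_zero, gaussSum_one_left hψ]
  have hmid : ∀ r ∈ Finset.range l, addCharCoeff χ⁻¹ ψ l.succ (r + 1) * χ a ^ (r + 1) =
      (l.succ : K)⁻¹ * (gaussSum (χ⁻¹ ^ (r + 1)) ψ * χ a ^ (r + 1)) := by
    intro r hr
    have : r < l := Finset.mem_range.1 hr
    rw [addCharCoeff, if_neg (by omega), if_neg (by omega)]
    ring
  rw [Finset.sum_congr rfl hmid, ← Finset.mul_sum, hpow]
  simp only [addCharCoeff, if_true, Nat.succ_ne_zero, if_false]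
  field_simp
  push_cast
  ring

end Expansion

theorem sum_pow_eq_zero_of_map_pow_ne_one {K F : Type*} [Field K] [Field F] {χ : MulChar F K}
    (s : Finset F) {c : F} (hc : c ≠ 0)
    (hs : ∀ x ∈ s, c * x ∈ s) {u : ℕ} (hu : χ c ^ u ≠ 1) : ∑ x ∈ s, χ x ^ u = 0 := by
  classical
  have himg : s.image (c * ·) = s :=
    Finset.eq_of_subset_of_card_le (Finset.image_subset_iff.2 hs)
      (Finset.card_image_of_injective _ (mul_right_injective₀ hc)).ge
  have h1 : ∑ x ∈ s, χ x ^ u = χ c ^ u * ∑ x ∈ s, χ x ^ u := by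
    conv_lhs => rw [← himg]
    rw [Finset.sum_image (mul_right_injective₀ hc).injOn, Finset.mul_sum]
    exact Finset.sum_congr rfl fun x _ => by rw [map_mul, mul_pow]
  by_contra h0
  exact hu (mul_right_cancel₀ h0 (by rw [one_mul, ← h1]))

/-! ### The point count as a character sum, and its separation into one-variable sums. -/

section CharacterSums

variable {K : Type*} [NormedField K] {F : Type*} [Field F] [Fintype F] {χ : MulChar F K}
  {ψ : AddChar F K}

theorem sum_addChar_mul_neg_pow_sub [DecidableEq F] {p e : ℕ} [Fact p.Prime] [CharP F p]
    (hψ1 : ψ ≠ 1) (hψ : ∀ x, ψ (x ^ p ^ e) = ψ x) (c : F) :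
    ∑ y : F, ψ (c * -(y ^ p ^ e - y)) = if c ^ p ^ e = c then (Fintype.card F : K) else 0 := by
  -- Frobenius invariance replaces ψ(cy) by ψ(c^q y^q), leaving a linear character in y^q.
  have h1 (y : F) : ψ (c * -(y ^ p ^ e - y)) = ψ (iterateFrobenius F p e y * (c ^ p ^ e - c)) := by
    rw [iterateFrobenius_def]
    have : c * -(y ^ p ^ e - y) = c * y + -(c * y ^ p ^ e) := by ring
    rw [this, AddChar.map_add_eq_mul, ← hψ (c * y), ← AddChar.map_add_eq_mul]
    congr 1
    ring
  simp_rw [h1]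
  rw [Function.Bijective.sum_comp (bijective_iterateFrobenius F p e)
    fun z => ψ (z * (c ^ p ^ e - c)),
    AddChar.sum_mulShift _ (AddChar.IsPrimitive.of_ne_one hψ1)]
  simp [sub_eq_zero]

theorem artinSchreierCount_eq_sum [DecidableEq F] {p e k : ℕ} [Fact p.Prime] [CharP F p]
    (hψ1 : ψ ≠ 1) (hψ : ∀ x, ψ (x ^ p ^ e) = ψ x) (hF : (Fintype.card F : K) ≠ 0)
    (f : MvPolynomial (Fin k) F) :
    (artinSchreierCount f (p ^ e) : K) =
      ∑ c : F with c ^ p ^ e = c, ∑ x : Fin k → F, ψ (c * MvPolynomial.eval x f) := by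
  rw [← mul_right_inj' hF, artinSchreierCount, Nat.card_eq_fintype_card, Fintype.card_subtype,
    Finset.natCast_card_filter, Finset.mul_sum]
  have h1 (z : (Fin k → F) × F) :
      (Fintype.card F : K) * (if MvPolynomial.eval z.1 f = z.2 ^ p ^ e - z.2 then 1 else 0) =
        ∑ c : F, ψ (c * (MvPolynomial.eval z.1 f - (z.2 ^ p ^ e - z.2))) := by
    rw [AddChar.sum_mulShift _ (AddChar.IsPrimitive.of_ne_one hψ1)]
    simp [sub_eq_zero]
  simp_rw [h1]
  rw [Finset.sum_comm, Finset.mul_sum, Finset.sum_filter]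
  refine Finset.sum_congr rfl fun c _ => ?_
  rw [Fintype.sum_prod_type]
  have h2 (x : Fin k → F) (y : F) :
      ψ (c * (MvPolynomial.eval x f - (y ^ p ^ e - y))) =
        ψ (c * MvPolynomial.eval x f) * ψ (c * -(y ^ p ^ e - y)) := by
    rw [sub_eq_add_neg, mul_add, AddChar.map_add_eq_mul]
  simp_rw [h2, ← Finset.mul_sum, sum_addChar_mul_neg_pow_sub hψ1 hψ]
  rw [← Finset.sum_mul]
  split_ifs
  · rw [mul_comm]
  · rw [mul_zero]

/-- The index set is stable under g^b, b = (#F - 1)/(q - 1), an element of order q - 1. This serves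
the c-sum and, with q = #F, the sums over the variables. -/
theorem dvd_of_sum_pow_ne_zero [DecidableEq F] (hχ : ∀ x, χ x = 1 → x = 1) {q u : ℕ} (hq : 0 < q)
    (hqF : q - 1 ∣ Fintype.card F - 1)
    (h0 : ∑ c : F with c ^ q = c, χ c ^ u ≠ 0) : q - 1 ∣ u := by
  obtain ⟨g, hg⟩ := IsCyclic.exists_generator (α := Fˣ)
  have hord : orderOf g = Fintype.card F - 1 := by
    rw [orderOf_eq_card_of_forall_mem_zpowers hg, Nat.card_eq_fintype_card, Fintype.card_units]
  have hpos : 0 < Fintype.card F - 1 := Nat.sub_pos_of_lt Fintype.one_lt_card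
  obtain ⟨b, hb⟩ := hqF
  have hb0 : 0 < b := Nat.pos_of_mul_pos_left (hb ▸ hpos)
  by_contra hdvd
  refine h0 (sum_pow_eq_zero_of_map_pow_ne_one _ (c := ((g ^ b : Fˣ) : F)) (Units.ne_zero _) ?_ ?_)
  · intro x hx
    have hx : x ^ q = x := by simpa using hx
    have : (g ^ b) ^ q = g ^ b := by
      rw [← Nat.sub_add_cancel hq, pow_succ, ← pow_mul, mul_comm b, ← hb, ← hord,
        pow_orderOf_eq_one, one_mul]
    simp only [Finset.mem_filter, Finset.mem_univ, true_and]
    rw [mul_pow, hx, ← Units.val_pow_eq_pow_val, this]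
  · rw [← map_pow, ← Units.val_pow_eq_pow_val]
    intro h1
    have h2 : (g ^ b) ^ u = 1 := Units.ext (hχ _ h1)
    rw [← pow_mul, ← orderOf_dvd_iff_pow_eq_one, hord, hb, mul_comm] at h2
    exact hdvd ((Nat.mul_dvd_mul_iff_left hb0).1 h2)

theorem AddChar.map_finsetSum {A M ι : Type*} [AddCommMonoid A] [CommMonoid M] (ψ : AddChar A M)
    (s : Finset ι) (f : ι → A) : ψ (∑ i ∈ s, f i) = ∏ i ∈ s, ψ (f i) := by
  classical
  induction s using Finset.induction_on with
  | empty => simp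
  | insert i s hi ih => rw [Finset.sum_insert hi, Finset.prod_insert hi, map_add_eq_mul, ih]

theorem sum_addChar_eq_sum {n k : ℕ} {C : ℕ → K}
    (hC : ∀ a, ψ a = ∑ r ∈ Finset.range (n + 1), C r * χ a ^ r) {I : Type*} [Fintype I]
    [DecidableEq I] (a : I → F) (D : I → Fin k → ℕ) (s : Finset F) :
    ∑ c ∈ s, ∑ x : Fin k → F, ψ (c * ∑ i, a i * ∏ l, x l ^ D i l) =
      ∑ r ∈ Fintype.piFinset fun _ : I => Finset.range (n + 1),
        (∏ i, C (r i) * χ (a i) ^ r i) * (∑ c ∈ s, χ c ^ ∑ i, r i) *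
          ∏ l, ∑ y : F, χ y ^ ∑ i, D i l * r i := by
  have h1 (c : F) (x : Fin k → F) : ψ (c * ∑ i, a i * ∏ l, x l ^ D i l) =
      ∑ r ∈ Fintype.piFinset fun _ : I => Finset.range (n + 1),
        (∏ i, C (r i) * χ (a i) ^ r i) * (χ c ^ ∑ i, r i) * ∏ l, χ (x l) ^ ∑ i, D i l * r i := by
    rw [Finset.mul_sum, AddChar.map_finsetSum]
    simp_rw [hC]
    rw [Finset.prod_univ_sum]
    refine Finset.sum_congr rfl fun r _ => ?_
    simp_rw [← Finset.prod_pow_eq_pow_sum]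
    rw [Finset.prod_comm, ← Finset.prod_mul_distrib, ← Finset.prod_mul_distrib]
    refine Finset.prod_congr rfl fun i _ => ?_
    simp_rw [map_mul, map_prod, map_pow, mul_pow, ← Finset.prod_pow, ← pow_mul]
    ring
  simp_rw [h1]
  simp_rw [Finset.sum_comm (s := Finset.univ) (t := Fintype.piFinset _)]
  rw [Finset.sum_comm]
  refine Finset.sum_congr rfl fun r _ => ?_
  rw [Finset.prod_univ_sum, Fintype.piFinset_univ]
  simp_rw [← Finset.mul_sum, ← Finset.sum_mul, ← Finset.mul_sum]

end CharacterSums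

/-! ### The combinatorial lower bound for total digit weight. -/

section Weights

variable {I : Type*} [Fintype I] {k p n h d Q : ℕ} {D : I → Fin k → ℕ} {r : I → ℕ}

theorem sum_mul_digitRotate_modEq (b : I → ℕ) (j : ℕ) :
    ∑ i, b i * digitRotate p n j (r i) ≡ p ^ j * ∑ i, b i * r i [MOD n] := by
  rw [Finset.mul_sum]
  refine Nat.ModEq.sum fun i _ => ?_
  rw [mul_left_comm]
  exact (digitRotate_modEq p n j (r i)).mul_left _

theorem dvd_sum_digitRotate_add (hQ : Q ∣ n) (hr : Q ∣ ∑ i, r i) (j t : ℕ) :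
    Q ∣ ∑ i, digitRotate p n j (r i) + t * n := by
  refine dvd_add ?_ (hQ.mul_left t)
  have := (sum_mul_digitRotate_modEq (p := p) (n := n) (r := r) (fun _ => 1) j).of_dvd hQ
  simp only [one_mul] at this
  exact (this.dvd_iff dvd_rfl).2 (hr.mul_left _)

theorem mul_le_mul_sum_digitRotate_add (hn : n + 1 = p ^ h) (hr : ∀ i, r i ≤ n) (hd : 1 ≤ d)
    (hD : ∀ i, ∑ l, D i l ≤ d) (hdvd : ∀ l, n ∣ ∑ i, D i l * r i) (j : ℕ) :
    k * n ≤ d * (∑ i, digitRotate p n j (r i) +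
      Finset.card {l | ∑ i, D i l * r i = 0} * n) := by
  -- Rotation keeps positive exponents positive (n goes to n, not 0), so a nonzero column sum stays
  -- a positive multiple of n.
  have h1 (l : Fin k) : n ≤ ∑ i, D i l * digitRotate p n j (r i) +
      if ∑ i, D i l * r i = 0 then n else 0 := by
    split_ifs with h0
    · exact Nat.le_add_left _ _
    · refine Nat.le_of_dvd ?_ ?_
      · obtain ⟨i, -, hi⟩ := Finset.exists_ne_zero_of_sum_ne_zero h0
        refine Finset.sum_pos' (fun _ _ => Nat.zero_le _) ⟨i, Finset.mem_univ i, ?_⟩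
        exact Nat.mul_pos (Nat.pos_of_ne_zero (left_ne_zero_of_mul hi))
          (digitRotate_pos hn (Nat.pos_of_ne_zero (right_ne_zero_of_mul hi)) (hr i) j)
      · exact ((sum_mul_digitRotate_modEq _ j).dvd_iff dvd_rfl).2 ((hdvd l).mul_left _)
  have h2 : ∑ l, ∑ i, D i l * digitRotate p n j (r i) ≤ d * ∑ i, digitRotate p n j (r i) := by
    rw [Finset.sum_comm, Finset.mul_sum]
    refine Finset.sum_le_sum fun i _ => ?_
    rw [← Finset.sum_mul]
    exact Nat.mul_le_mul_right _ (hD i)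
  have h3 := Finset.sum_le_sum fun l (_ : l ∈ Finset.univ) => h1 l
  rw [Finset.sum_add_distrib, ← Finset.sum_filter, Finset.sum_const, Finset.sum_const,
    Finset.card_univ, Fintype.card_fin, smul_eq_mul, smul_eq_mul] at h3
  rw [mul_add]
  exact h3.trans (Nat.add_le_add h2 (Nat.le_mul_of_pos_left _ hd))

theorem mul_ceil_le_mul_sum_digitWeight (hn : n + 1 = p ^ h) (hn0 : 0 < n)
    (hr : ∀ i, r i ≤ n) (hd : 1 ≤ d) (hD : ∀ i, ∑ l, D i l ≤ d)
    (hdvd : ∀ l, n ∣ ∑ i, D i l * r i) (hQ : Q ∣ n) (hQr : Q ∣ ∑ i, r i) :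
    (p - 1) * (h * (Q * ⌈(k * n : ℚ) / (d * Q)⌉₊)) ≤
      n * (∑ i, digitWeight p n h (r i) +
        (p - 1) * h * Finset.card {l | ∑ i, D i l * r i = 0}) := by
  have hQ0 : 0 < Q := Nat.pos_of_dvd_of_pos hQ hn0
  set t := Finset.card {l | ∑ i, D i l * r i = 0}
  have hj (j : ℕ) : Q * ⌈(k * n : ℚ) / (d * Q)⌉₊ ≤ ∑ i, digitRotate p n j (r i) + t * n := by
    obtain ⟨b, hb⟩ := dvd_sum_digitRotate_add (p := p) hQ hQr j t
    rw [hb]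
    refine Nat.mul_le_mul_left _ (Nat.ceil_le.2 ?_)
    have := mul_le_mul_sum_digitRotate_add hn hr hd hD hdvd j
    rw [hb] at this
    rw [div_le_iff₀ (by positivity)]
    calc (k * n : ℚ) ≤ ((d * (Q * b) : ℕ) : ℚ) := by exact_mod_cast this
      _ = b * (d * Q) := by push_cast; ring
  have hsum := Finset.sum_le_sum fun j (_ : j ∈ Finset.range h) => hj j
  rw [Finset.sum_const, Finset.card_range, smul_eq_mul, Finset.sum_add_distrib, Finset.sum_comm,
    Finset.sum_const, Finset.card_range, smul_eq_mul] at hsum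
  refine (Nat.mul_le_mul_left (p - 1) hsum).trans_eq ?_
  rw [mul_add, Finset.mul_sum, mul_add, Finset.mul_sum]
  congr 1
  · exact Finset.sum_congr rfl fun i _ => (mul_digitWeight hn hn0 (hr i)).symm
  · ring

end Weights

/-! ### From norms of natural numbers to p-adic valuations. -/

section Ultrametric

variable {K : Type*} [NormedField K] [IsUltrametricDist K] {p : ℕ}

theorem norm_natCast_eq_one_of_not_dvd (hp : p.Prime) (hpK : ‖(p : K)‖ < 1) {a : ℕ}
    (ha : ¬ p ∣ a) : ‖(a : K)‖ = 1 := by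
  refine le_antisymm (IsUltrametricDist.norm_natCast_le_one K a) (le_of_not_gt fun hlt => ?_)
  have hco : IsCoprime (a : ℤ) (p : ℤ) :=
    Nat.isCoprime_iff_coprime.2 ((Nat.Prime.coprime_iff_not_dvd hp).2 ha).symm
  obtain ⟨u, v, huv⟩ := hco
  have h1 : (u : K) * a + v * p = 1 := by exact_mod_cast congrArg (Int.cast : ℤ → K) huv
  have h2 : ‖(u : K) * a + v * p‖ < 1 := by
    refine (IsUltrametricDist.norm_add_le_max _ _).trans_lt (max_lt ?_ ?_)
    · rw [norm_mul]
      exact mul_lt_one_of_nonneg_of_lt_one_right (IsUltrametricDist.norm_intCast_le_one K u)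
        (norm_nonneg _) hlt
    · rw [norm_mul]
      exact mul_lt_one_of_nonneg_of_lt_one_right (IsUltrametricDist.norm_intCast_le_one K v)
        (norm_nonneg _) hpK
  rw [h1, norm_one] at h2
  exact lt_irrefl _ h2

theorem le_mul_of_norm_natCast_le (hp : p.Prime) (hpK : ‖(p : K)‖ < 1) {ϖ : ℝ} (hϖ : 0 < ϖ)
    (hϖp : ϖ ^ (p - 1) = ‖(p : K)‖) {N M v : ℕ} (hv : emultiplicity p N = v)
    (hN : ‖(N : K)‖ ≤ ϖ ^ M) : M ≤ (p - 1) * v := by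
  have hϖ1 : ϖ < 1 := by
    by_contra! h
    exact (one_le_pow₀ h).not_gt (hϖp ▸ hpK)
  obtain ⟨⟨a, rfl⟩, hndvd⟩ := emultiplicity_eq_coe.1 hv
  have ha : ¬ p ∣ a := fun ⟨b, hb⟩ => hndvd ⟨b, by rw [hb, pow_succ, mul_assoc]⟩
  rw [Nat.cast_mul, Nat.cast_pow, norm_mul, norm_pow, norm_natCast_eq_one_of_not_dvd hp hpK ha,
    mul_one, ← hϖp, ← pow_mul] at hN
  exact (pow_le_pow_iff_right_of_lt_one₀ hϖ hϖ1).1 hN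

end Ultrametric

/-! ### The trace character. -/

section TraceCharacter

variable {p : ℕ} [hp : Fact p.Prime] (F : Type*) [Field F] [Fintype F] [Algebra (ZMod p) F]
  {K : Type*} [Field K]

theorem exists_addChar_eq_pow_trace {ζ : K} (hζ : IsPrimitiveRoot ζ p) :
    ∃ ψ : AddChar F K, ψ ≠ 1 ∧ (∀ x, ψ x = ζ ^ (Algebra.trace (ZMod p) F x).val) ∧
      ∀ e x, ψ (x ^ p ^ e) = ψ x := by
  let ψ : AddChar F K := (AddChar.zmodChar p hζ.pow_eq_one).compAddMonoidHom
    (Algebra.trace (ZMod p) F).toAddMonoidHom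
  have hψ (x : F) : ψ x = ζ ^ (Algebra.trace (ZMod p) F x).val := rfl
  have hfrob (x : F) : ψ (x ^ p) = ψ x := by
    have := Algebra.trace_eq_of_algEquiv (FiniteField.frobeniusAlgEquivOfAlgebraic (ZMod p) F) x
    rw [FiniteField.coe_frobeniusAlgEquivOfAlgebraic, ZMod.card] at this
    rw [hψ, hψ, this]
  refine ⟨ψ, fun h1 => ?_, hψ, fun e x => ?_⟩
  · obtain ⟨x, hx⟩ := Algebra.trace_surjective (ZMod p) F 1
    have h2 := hψ x
    rw [h1, AddChar.one_apply, hx, ZMod.val_one, pow_one] at h2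
    exact hζ.ne_one hp.out.one_lt h2.symm
  · induction e with
    | zero => simp
    | succ e ih => rw [pow_succ, pow_mul, hfrob, ih]

end TraceCharacter

/-! ### Assembly of the estimates. -/

theorem norm_sum_pow_le {K : Type*} [NormedField K] [IsUltrametricDist K] {F : Type*} [Field F]
    [Fintype F] (χ : MulChar F K) (s : Finset F) (u : ℕ) : ‖∑ c ∈ s, χ c ^ u‖ ≤ 1 :=
  IsUltrametricDist.norm_sum_le_of_forall_le_of_nonneg zero_le_one fun c _ => by
    rw [norm_pow]
    exact pow_le_one₀ (norm_nonneg _) (χ.norm_apply_le_one c)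

theorem MvPolynomial.eval_eq_sum_support {k : ℕ} {F : Type*} [Field F] (f : MvPolynomial (Fin k) F)
    (x : Fin k → F) :
    MvPolynomial.eval x f = ∑ i : f.support, f.coeff i * ∏ l, x l ^ (i : Fin k →₀ ℕ) l := by
  rw [MvPolynomial.eval_eq', ← Finset.sum_coe_sort]

theorem mul_ceil_le_mul_of_emultiplicity_eq {p e h n k d v : ℕ} (hp : p.Prime)
    {F : Type*} [Field F] [Fintype F] (hF : Fintype.card F = p ^ h) (hn : n + 1 = p ^ h)
    (hn0 : 0 < n) (hQ : p ^ e - 1 ∣ n) (f : MvPolynomial (Fin k) F) (hd : 1 ≤ d)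
    (hf : f.totalDegree ≤ d) (hv : emultiplicity p (artinSchreierCount f (p ^ e)) = v) :
    h * ((p ^ e - 1) * ⌈(k * n : ℚ) / (d * (p ^ e - 1 : ℕ))⌉₊) ≤ n * v := by
  classical
  have hp' : Fact p.Prime := ⟨hp⟩
  have hchar : CharP F p := charP_of_card_eq_prime_pow hF
  let _ : Algebra (ZMod p) F := ZMod.algebra F p
  have hpK : ‖(p : PadicAlgCl p)‖ < 1 := by
    rw [PadicAlgCl.norm_natCast_prime]
    exact inv_lt_one_of_one_lt₀ (Nat.one_lt_cast.2 hp.one_lt)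
  have hpn : ¬ p ∣ n := by
    rw [← Nat.Prime.coprime_iff_not_dvd hp]
    exact (coprime_of_add_one_eq_pow hn hn0).symm
  have hnK : ‖(n : PadicAlgCl p)‖ = 1 := norm_natCast_eq_one_of_not_dvd hp hpK hpn
  obtain ⟨ζ, hζ⟩ := HasEnoughRootsOfUnity.exists_primitiveRoot (PadicAlgCl p) p
  have hϖp := hζ.norm_sub_one_pow
  have hϖ : 0 < ‖ζ - 1‖ := norm_pos_iff.2 (sub_ne_zero.2 (hζ.ne_one hp.one_lt))
  have hζ1 : ‖ζ‖ = 1 := norm_eq_one_of_pow_eq_one hζ.pow_eq_one hp.ne_zero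
  have hϖ1 : ‖ζ - 1‖ < 1 := by
    by_contra! h1
    exact (one_le_pow₀ h1).not_gt (hϖp ▸ hpK)
  obtain ⟨ψ, hψ1, hψ, hψp⟩ := exists_addChar_eq_pow_trace F hζ
  obtain ⟨χ, hχ⟩ := exists_teichmuller_mulChar p F
  have hord : orderOf χ = n := by rw [orderOf_eq_card_sub_one hχ]; omega
  have hinj (x : F) (hx : χ x = 1) : x = 1 := eq_one_of_map_eq_one hχ hx
  have hgauss (h1 : 1 < n) : ‖ζ - 1‖ ≤ ‖gaussSum χ⁻¹ ψ‖ :=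
    norm_sub_one_le_norm_gaussSum_inv hχ (fun h0 => by simp [h0] at hord; omega) hζ1 hϖ1 hψ
  have hcoeff {r : ℕ} (hr : r ≤ n) := norm_addCharCoeff_le hp hn hn0 hF
    ((orderOf_inv χ).trans hord) hnK hψ1 (fun x => by simpa using hψp 1 x) hϖ hϖp hgauss hr
  have hexp := addChar_eq_sum (hn.trans hF.symm) hn0 (norm_ne_zero_iff.1 (hnK ▸ one_ne_zero))
    hinj hψ1
  have hcount := artinSchreierCount_eq_sum hψ1 (hψp e) (by
    rw [hF, Nat.cast_ne_zero]; exact pow_ne_zero _ hp.ne_zero) f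
  simp_rw [MvPolynomial.eval_eq_sum_support] at hcount
  rw [sum_addChar_eq_sum hexp] at hcount
  -- Only a term of norm at least ‖N‖ matters; since N ≠ 0 it is nonzero, which yields all the
  -- divisibilities.
  obtain ⟨r, hr, hle⟩ := IsUltrametricDist.exists_norm_finsetSum_le_of_nonempty
    (Fintype.piFinset_nonempty.2 fun _ : f.support => Finset.nonempty_range_iff.2 n.succ_ne_zero)
    (fun r => (∏ i, addCharCoeff χ⁻¹ ψ n (r i) * χ (f.coeff i) ^ r i) *
      (∑ c : F with c ^ p ^ e = c, χ c ^ ∑ i, r i) *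
        ∏ l, ∑ y : F, χ y ^ ∑ i : f.support, (i : Fin k →₀ ℕ) l * r i)
  rw [← hcount] at hle
  have hr (i : f.support) : r i ≤ n := by
    have := Fintype.mem_piFinset.1 hr i
    rw [Finset.mem_range] at this
    omega
  have hcount0 : artinSchreierCount f (p ^ e) ≠ 0 := by
    intro h0
    simp [h0] at hv
  have hne := (norm_pos_iff.2 (Nat.cast_ne_zero.2 hcount0)).trans_le hle
  rw [norm_pos_iff, mul_ne_zero_iff, mul_ne_zero_iff] at hne
  obtain ⟨⟨-, hne1⟩, hne2⟩ := hne
  have hQr : p ^ e - 1 ∣ ∑ i, r i := dvd_of_sum_pow_ne_zero hinj (pow_pos hp.pos e)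
    (by rwa [hF, ← hn, Nat.add_sub_cancel]) hne1
  have hdvd (l : Fin k) : n ∣ ∑ i : f.support, (i : Fin k →₀ ℕ) l * r i := by
    have := dvd_of_sum_pow_ne_zero hinj (q := Fintype.card F) Fintype.card_pos dvd_rfl
      (by simpa [FiniteField.pow_card] using Finset.prod_ne_zero_iff.1 hne2 l (Finset.mem_univ l))
    rwa [hF, ← hn, Nat.add_sub_cancel] at this
  have hD (i : f.support) : ∑ l, (i : Fin k →₀ ℕ) l ≤ d := by
    refine le_trans (le_of_eq ?_) ((MvPolynomial.le_totalDegree i.2).trans hf)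
    rw [Finsupp.sum_fintype _ _ fun _ => rfl]
  have hkey := mul_ceil_le_mul_sum_digitWeight hn hn0 hr hd hD hdvd hQ hQr
  have hM := le_mul_of_norm_natCast_le hp hpK hϖ hϖp hv (hle.trans (b := _)
    (c := ‖ζ - 1‖ ^ (∑ i, digitWeight p n h (r i) +
      (p - 1) * h * Finset.card {l | ∑ i : f.support, (i : Fin k →₀ ℕ) l * r i = 0})) ?_)
  · have := hkey.trans (Nat.mul_le_mul_left n hM)
    rw [mul_left_comm n] at this
    exact Nat.le_of_mul_le_mul_left this (Nat.sub_pos_of_lt hp.one_lt)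
  rw [norm_mul, norm_mul, pow_add]
  refine mul_le_mul ?_ ?_ (norm_nonneg _) (pow_nonneg hϖ.le _)
  · refine (mul_le_of_le_one_right (norm_nonneg _) (norm_sum_pow_le χ _ _)).trans ?_
    rw [norm_prod, ← Finset.prod_pow_eq_pow_sum]
    refine Finset.prod_le_prod (fun _ _ => norm_nonneg _) fun i _ => ?_
    rw [norm_mul, norm_pow]
    exact (mul_le_of_le_one_right (norm_nonneg _)
      (pow_le_one₀ (norm_nonneg _) (χ.norm_apply_le_one _))).trans (hcoeff (hr i))
  · rw [norm_prod, mul_comm, pow_mul', ← Finset.prod_const, Finset.prod_filter]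
    refine Finset.prod_le_prod (fun _ _ => norm_nonneg _) fun l _ => ?_
    split_ifs with h0
    · rw [h0]
      simp only [pow_zero, Finset.sum_const, Finset.card_univ, nsmul_eq_mul, mul_one]
      rw [hF, Nat.cast_pow, norm_pow, ← hϖp, pow_mul]
    · exact norm_sum_pow_le χ _ _

theorem mainTheorem5 (p e m q k d : ℕ) (hp : p.Prime) (he : 1 ≤ e) (hm : 1 ≤ m)
    (hq : q = p ^ e) {F : Type*} [Field F] [Finite F] (hF : Nat.card F = q ^ m)
    (f : MvPolynomial (Fin k) F) (hd : 1 ≤ d) (hf : f.totalDegree = d) :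
    ((⌈((e : ℚ) * m * (q - 1)) / ((q : ℚ) ^ m - 1) *
        (⌈((k : ℚ) * ((q : ℚ) ^ m - 1)) / (d * (q - 1))⌉₊ : ℚ)⌉₊ : ℕ) : ℕ∞) ≤
      emultiplicity p (artinSchreierCount f q) := by
  rcases eq_or_ne (emultiplicity p (artinSchreierCount f q)) ⊤ with htop | htop
  · rw [htop]
    exact le_top
  obtain ⟨v, hv⟩ := ENat.ne_top_iff_exists.1 htop
  rw [← hv, Nat.cast_le, Nat.ceil_le]
  subst hq
  have := Fintype.ofFinite F
  rw [Nat.card_eq_fintype_card, ← pow_mul] at hF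
  have h1 : 1 < p ^ (e * m) := Nat.one_lt_pow (by positivity) hp.one_lt
  have h2 : 1 ≤ p ^ e := Nat.one_le_pow _ _ hp.pos
  have hQ : p ^ e - 1 ∣ p ^ (e * m) - 1 := by
    rw [pow_mul]
    exact Nat.sub_one_dvd_pow_sub_one _ _
  have key := mul_ceil_le_mul_of_emultiplicity_eq hp hF (Nat.sub_add_cancel h1.le)
    (Nat.sub_pos_of_lt h1) hQ f hd hf.le hv.symm
  have hn : ((p ^ (e * m) - 1 : ℕ) : ℚ) = ((p ^ e : ℕ) : ℚ) ^ m - 1 := by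
    rw [Nat.cast_sub h1.le, pow_mul]; push_cast; rfl
  have hq : ((p ^ e - 1 : ℕ) : ℚ) = ((p ^ e : ℕ) : ℚ) - 1 := by
    rw [Nat.cast_sub h2, Nat.cast_one]
  have hpos : (0 : ℚ) < ((p ^ e : ℕ) : ℚ) ^ m - 1 := by
    rw [← hn]
    exact_mod_cast Nat.sub_pos_of_lt h1
  rw [hn, hq] at key
  rw [div_mul_eq_mul_div, div_le_iff₀ hpos]
  calc _ = ((e * m * ((p ^ e - 1) *
        ⌈((k : ℚ) * (((p ^ e : ℕ) : ℚ) ^ m - 1)) / (d * (((p ^ e : ℕ) : ℚ) - 1))⌉₊) : ℕ) : ℚ) := by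
        rw [Nat.cast_mul, Nat.cast_mul, Nat.cast_mul, hq]
        ring
    _ ≤ (((p ^ (e * m) - 1) * v : ℕ) : ℚ) := Nat.cast_le.2 key
    _ = _ := by rw [Nat.cast_mul, hn, mul_comm]
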